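/- Let $n\ge 1$, let $\mathcal E$ be a complex Hilbert space, and let $\mathcal E_n=H^2_{\mathcal E}(\mathbb D^n)$ be the $\mathcal E$-valued Hardy space over the polydisc, i.e. the reproducing kernel Hilbert space of $\mathcal E$-valued functions on $\mathbb D^n$ with kernel $\prod_{i=1}^n(1-z_i\bar w_i)^{-1}I_{\mathcal E}$. For a Hilbert space $\mathcal L$ let $H^2_{\mathcal L}(\mathbb D)$ be the $\mathcal L$-valued Hardy space over the disc, with kernel $(1-z\bar w)^{-1}I_{\mathcal L}$; write $M_\varphi$ for the bounded operator $(M_\varphi f)(w)=\varphi(w)f(w)$ between such spaces, whenever it exists, and $M_z$ for multiplication by the coordinate. For $i=1,\dots,n$ let $\kappa_i$ be the constant function on $\mathbb D$ whose value is the operator $M_{z_i}$ of multiplication by $z_i$ on $\mathcal E_n$. A shift is an isometry $V$ with $\|V^{*m}f\|\to0$ for all $f$. An inner function is a bounded analytic operator-valued function $\Theta$ on $\mathbb D$ for which $M_\Theta$ is an isometry. Let $\mathcal S\subseteq H^2_{\mathcal E_n}(\mathbb D)$ be a closed subspace with $M_z\mathcal S\subseteq\mathcal S$, let $\mathcal W=\mathcal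 S\ominus z\mathcal S$, and let $\Theta$ be the Beurling–Lax–Halmos function of $\mathcal S$, that is, the $\mathcal B(\mathcal W,\mathcal E_n)$-valued function on $\mathbb D$ given by $\Theta(w)\eta=\eta(w)$ for $w\in\mathbb D$, $\eta\in\mathcal W$ (equivalently, $M_\Theta$ sends each constant function $\eta\in\mathcal W\subseteq H^2_{\mathcal W}(\mathbb D)$ to the function $\eta\in\mathcal S$). Then $\Theta$ is inner and $\mathcal S=\Theta H^2_{\mathcal W}(\mathbb D)$. Set $$\Phi_i(w)=P_{\mathcal W}M_\Theta\,(I_{H^2_{\mathcal W}(\mathbb D)}-wM_z^*)^{-1}M_\Theta^*M_{\kappa_i}|_{\mathcal W}\in\mathcal B(\mathcal W)\qquad(w\in\mathbb D,\ i=1,\dots,n).$$ Then $\mathcal S$ is invariant for $(M_{\kappa_1},\dots,M_{\kappa_n})$ if and only if $(M_{\Phi_1},\dots,M_{\Phi_n})$ is an $n$-tuple of (bounded) commuting shifts on $H^2_{\mathcal W}(\mathbb D)$ and $$\kappa_i\Theta=\Theta\Phi_i\qquad(i=1,\dots,n).$$ Moreover, in this case $(M_z|_{\mathcal S},M_{\kappa_1}|_{\mathcal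 S},\dots,M_{\kappa_n}|_{\mathcal S})$ on $\mathcal S$ and $(M_z,M_{\Phi_1},\dots,M_{\Phi_n})$ on $H^2_{\mathcal W}(\mathbb D)$ are unitarily equivalent: a single unitary $U:\mathcal S\to H^2_{\mathcal W}(\mathbb D)$ intertwines all $n+1$ pairs of operators. -/

import Mathlib

open scoped Complex.UnitDisc InnerProductSpace
open Filter Topology

set_option linter.unusedSectionVars false

noncomputable section

/-! ### Square-summable families, evaluated through a system of scalar functions -/

namespace CoeffSpace

variable {κ E F : Type*} [NormedAddCommGroup E] [InnerProductSpace ℂ E]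
  [NormedAddCommGroup F] [InnerProductSpace ℂ F]

theorem summable_sq (f : lp (fun _ : κ => E) 2) : Summable fun k => ‖f k‖ ^ 2 := by
  simpa using (lp.memℓp f).summable (by norm_num)

theorem norm_sq (f : lp (fun _ : κ => E) 2) : ‖f‖ ^ 2 = ∑' k, ‖f k‖ ^ 2 := by
  have := lp.norm_rpow_eq_tsum (p := 2) (by norm_num) f
  simpa using this

theorem memlp (f : κ → E) (h : Summable fun k => ‖f k‖ ^ 2) : Memℓp f 2 :=
  memℓp_gen (by simpa using h)

theorem summable_smul [CompleteSpace E] (c : κ → ℂ) (hc : Summable fun k => ‖c k‖ ^ 2)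
    (f : lp (fun _ : κ => E) 2) : Summable fun k => ‖c k • f k‖ := by
  refine Summable.of_nonneg_of_le (fun _ => norm_nonneg _) (fun k => ?_)
    (hc.add (summable_sq f))
  rw [norm_smul]
  nlinarith [sq_nonneg (‖c k‖ - ‖f k‖), sq_nonneg (‖c k‖), sq_nonneg (‖f k‖)]

/-- The continuous functional `f ↦ ∑ c_k f_k` on square-summable families, for square-summable
scalars `c`. -/
def evalCLM [CompleteSpace E] (c : κ → ℂ) (hc : Summable fun k => ‖c k‖ ^ 2) :
    lp (fun _ : κ => E) 2 →L[ℂ] E :=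
  LinearMap.mkContinuous
    { toFun := fun f => ∑' k, c k • f k
      map_add' := fun f g => by
        rw [← (summable_smul c hc f).of_norm.tsum_add (summable_smul c hc g).of_norm]
        simp
      map_smul' := fun a f => by
        rw [RingHom.id_apply, ← (summable_smul c hc f).of_norm.tsum_const_smul]
        simp [smul_comm a] }
    (√(∑' k, ‖c k‖ ^ 2)) (fun f => by
      refine (norm_tsum_le_tsum_norm (summable_smul c hc f)).trans ?_
      have h := Real.inner_le_Lp_mul_Lq_tsum_of_nonneg (p := 2) (q := 2)
        (f := fun k => ‖c k‖) (g := fun k => ‖f k‖) Real.HolderConjugate.two_two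
        (fun _ => norm_nonneg _) (fun _ => norm_nonneg _) (by simpa using hc)
        (by simpa using summable_sq f)
      simp only [Real.rpow_two, ← Real.sqrt_eq_rpow, ← norm_sq] at h
      simpa [norm_smul, Real.sqrt_sq] using h)

theorem evalCLM_apply [CompleteSpace E] (c : κ → ℂ) (hc : Summable fun k => ‖c k‖ ^ 2)
    (f : lp (fun _ : κ => E) 2) : evalCLM c hc f = ∑' k, c k • f k := rfl

theorem adjoint_evalCLM_apply [CompleteSpace E] (c : κ → ℂ) (hc : Summable fun k => ‖c k‖ ^ 2)
    (v : E) (k : κ) :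
    (evalCLM c hc).adjoint v k = (starRingEnd ℂ) (c k) • v := by
  classical
  refine ext_inner_left ℂ fun u => ?_
  have h1 := lp.inner_single_left (𝕜 := ℂ) (G := fun _ : κ => E) k u ((evalCLM c hc).adjoint v)
  rw [← h1, ContinuousLinearMap.adjoint_inner_right, evalCLM_apply, tsum_eq_single k]
  · rw [lp.single_apply_self, inner_smul_left, inner_smul_right]
  · intro j hj
    rw [lp.single_apply_ne _ _ _ hj, smul_zero]

/-- Moving the coefficients along an injection `σ` of the index set. -/
def push (σ : κ → κ) (hσ : Function.Injective σ) :
    lp (fun _ : κ => E) 2 →L[ℂ] lp (fun _ : κ => E) 2 :=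
  have key : ∀ f : lp (fun _ : κ => E) 2,
      HasSum (fun k => ‖Function.extend σ (f : κ → E) 0 k‖ ^ 2) (‖f‖ ^ 2) := fun f => by
    have h : HasSum ((fun k => ‖Function.extend σ (f : κ → E) 0 k‖ ^ 2) ∘ σ) (‖f‖ ^ 2) := by
      rw [norm_sq]
      convert (summable_sq f).hasSum using 2 with k
      simp [hσ.extend_apply]
    refine (hσ.hasSum_iff fun k hk => ?_).1 h
    rw [Function.extend_apply' _ _ _ (by simpa using hk)]
    simp
  LinearMap.mkContinuous
    { toFun := fun f => ⟨Function.extend σ (f : κ → E) 0, memlp _ (key f).summable⟩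
      map_add' := fun f g => by
        refine lp.ext (funext fun k => ?_)
        change Function.extend σ ((f : κ → E) + (g : κ → E)) (0 : κ → E) k =
          Function.extend σ (f : κ → E) (0 : κ → E) k +
            Function.extend σ (g : κ → E) (0 : κ → E) k
        by_cases hk : ∃ j, σ j = k
        · obtain ⟨j, rfl⟩ := hk
          simp [hσ.extend_apply]
        · simp [Function.extend_apply' _ _ _ hk]
      map_smul' := fun a f => by
        ext k
        by_cases hk : ∃ j, σ j = k
        · obtain ⟨j, rfl⟩ := hk
          simp [hσ.extend_apply]
        · simp [Function.extend_apply' _ _ _ hk] }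
    1 (fun f => by
      rw [one_mul]
      refine le_of_sq_le_sq ?_ (norm_nonneg _)
      rw [norm_sq]
      exact (key f).tsum_eq.le)

theorem evalCLM_push [CompleteSpace E] (c : κ → ℂ) (hc : Summable fun k => ‖c k‖ ^ 2)
    (σ : κ → κ) (hσ : Function.Injective σ) (a : ℂ) (ha : ∀ k, c (σ k) = a * c k)
    (f : lp (fun _ : κ => E) 2) :
    evalCLM c hc (push σ hσ f) = a • evalCLM c hc f := by
  rw [evalCLM_apply, evalCLM_apply, ← (summable_smul c hc f).of_norm.tsum_const_smul]
  rw [← hσ.tsum_eq]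
  · refine tsum_congr fun k => ?_
    change c (σ k) • Function.extend σ (f : κ → E) 0 (σ k) = _
    rw [hσ.extend_apply, ha, mul_smul]
  · intro k hk
    by_contra hk'
    apply hk
    change c k • Function.extend σ (f : κ → E) 0 k = 0
    rw [Function.extend_apply' _ _ _ (by simpa using hk')]
    simp

/-- Applying a bounded operator to every coefficient. -/
def mapCoeff (T : E →L[ℂ] F) : lp (fun _ : κ => E) 2 →L[ℂ] lp (fun _ : κ => F) 2 :=
  have key : ∀ (f : lp (fun _ : κ => E) 2) k, ‖T (f k)‖ ^ 2 ≤ ‖T‖ ^ 2 * ‖f k‖ ^ 2 := fun f k => by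
    rw [← mul_pow]
    exact pow_le_pow_left₀ (norm_nonneg _) (T.le_opNorm _) 2
  have summ : ∀ f : lp (fun _ : κ => E) 2, Summable fun k => ‖T (f k)‖ ^ 2 := fun f =>
    Summable.of_nonneg_of_le (fun _ => sq_nonneg _) (key f) ((summable_sq f).mul_left _)
  LinearMap.mkContinuous
    { toFun := fun f => ⟨fun k => T (f k), memlp _ (summ f)⟩
      map_add' := fun f g => lp.ext (funext fun k => map_add T (f k) (g k))
      map_smul' := fun a f => by ext k; simp }
    ‖T‖ (fun f => by
      refine le_of_sq_le_sq ?_ (by positivity)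
      rw [norm_sq, mul_pow, norm_sq f, ← tsum_mul_left]
      exact (summ f).tsum_le_tsum (key f) ((summable_sq f).mul_left _))

theorem evalCLM_mapCoeff [CompleteSpace E] [CompleteSpace F] (c : κ → ℂ)
    (hc : Summable fun k => ‖c k‖ ^ 2) (T : E →L[ℂ] F) (f : lp (fun _ : κ => E) 2) :
    evalCLM c hc (mapCoeff T f) = T (evalCLM c hc f) := by
  rw [evalCLM_apply, evalCLM_apply, T.map_tsum (summable_smul c hc f).of_norm]
  refine tsum_congr fun k => ?_
  change c k • T (f k) = _
  simp

end CoeffSpace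


/-! ### Monomials -/

namespace Monomial

/-- The monomial `z ^ k = z₁ ^ k₁ ⋯ zₙ ^ kₙ`. -/
def mono {n : ℕ} (k : Fin n → ℕ) (z : Fin n → ℂ) : ℂ := ∏ i, z i ^ k i

theorem summable_hasSum (n : ℕ) (x : Fin n → ℂ) (hx : ∀ i, ‖x i‖ < 1) :
    (Summable fun k : Fin n → ℕ => ‖mono k x‖) ∧
      HasSum (fun k : Fin n → ℕ => mono k x) (∏ i, (1 - x i)⁻¹) := by
  induction n with
  | zero =>
    refine ⟨(hasSum_unique _).summable, ?_⟩
    have h := hasSum_unique (fun k : Fin 0 → ℕ => mono k x)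
    simpa only [Finset.univ_eq_empty, Finset.prod_empty, mono] using h
  | succ n ih =>
    obtain ⟨h1, h2⟩ := ih (fun i => x i.succ) (fun i => hx _)
    have g1 : Summable fun k : ℕ => ‖x 0 ^ k‖ := by
      simpa using summable_geometric_of_lt_one (norm_nonneg _) (hx 0)
    have g2 := hasSum_geometric_of_norm_lt_one (hx 0)
    have e : ∀ p : ℕ × (Fin n → ℕ), mono (Fin.consEquiv (fun _ => ℕ) p) x =
        x 0 ^ p.1 * mono p.2 (fun i => x i.succ) := fun p => by
      simp [mono, Fin.prod_univ_succ, Fin.consEquiv]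
    have hs : Summable fun p : ℕ × (Fin n → ℕ) =>
        ‖x 0 ^ p.1 * mono p.2 (fun i => x i.succ)‖ := by
      simpa only [norm_mul] using g1.mul_of_nonneg h1 (fun _ => norm_nonneg _)
        (fun _ => norm_nonneg _)
    constructor
    · rw [← (Fin.consEquiv (fun _ => ℕ)).summable_iff]
      exact hs.congr fun p => by simp [e]
    · rw [← (Fin.consEquiv (fun _ => ℕ)).hasSum_iff, Fin.prod_univ_succ]
      refine (g2.mul h2 hs.of_norm).congr_fun ?_
      intro p
      exact e p

theorem eq_zero_one {E : Type*} [NormedAddCommGroup E] [NormedSpace ℂ E] [CompleteSpace E]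
    (a : ℕ → E) (hs : ∀ w : ℂ, ‖w‖ < 1 → Summable fun k => ‖w ^ k • a k‖)
    (h0 : ∀ w : ℂ, ‖w‖ < 1 → ∑' k, w ^ k • a k = 0) (k : ℕ) : a k = 0 := by
  let p : FormalMultilinearSeries ℂ ℂ E := fun k => ContinuousMultilinearMap.mkPiRing ℂ (Fin k) (a k)
  have hp : HasFPowerSeriesAt (0 : ℂ → E) p 0 := by
    rw [hasFPowerSeriesAt_iff]
    filter_upwards [Metric.ball_mem_nhds (0 : ℂ) one_pos] with w hw
    have hw' : ‖w‖ < 1 := by simpa using hw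
    have := (hs w hw').of_norm.hasSum
    rw [h0 w hw'] at this
    simpa [p, FormalMultilinearSeries.coeff] using this
  have := congrArg (fun q : FormalMultilinearSeries ℂ ℂ E => q.coeff k) hp.eq_zero
  simpa [p, FormalMultilinearSeries.coeff] using this

theorem eq_zero {E : Type*} [NormedAddCommGroup E] [NormedSpace ℂ E] [CompleteSpace E]
    (n : ℕ) (a : (Fin n → ℕ) → E)
    (hs : ∀ z : Fin n → ℂ, (∀ i, ‖z i‖ < 1) → Summable fun k => ‖mono k z • a k‖)
    (h0 : ∀ z : Fin n → ℂ, (∀ i, ‖z i‖ < 1) → ∑' k, mono k z • a k = 0) (k : Fin n → ℕ) :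
    a k = 0 := by
  induction n with
  | zero =>
    have h := h0 0 (fun i => i.elim0)
    rw [tsum_eq_single k (fun j hj => (hj (Subsingleton.elim _ _)).elim)] at h
    simpa [mono] using h
  | succ n ih =>
    have e : ∀ (w : ℂ) (z : Fin n → ℂ) (p : ℕ × (Fin n → ℕ)),
        mono (Fin.consEquiv (fun _ => ℕ) p) (Fin.cons w z : Fin (n + 1) → ℂ) =
          w ^ p.1 * mono p.2 z := fun w z p => by
      simp [mono, Fin.prod_univ_succ, Fin.consEquiv]
    have hb : ∀ (w : ℂ) (z : Fin n → ℂ), ‖w‖ < 1 → (∀ i, ‖z i‖ < 1) →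
        ∀ i, ‖(Fin.cons w z : Fin (n + 1) → ℂ) i‖ < 1 := fun w z hw hz i => by
      refine Fin.cases ?_ ?_ i
      · simpa using hw
      · simpa using hz
    have hS : ∀ (w : ℂ) (z : Fin n → ℂ), ‖w‖ < 1 → (∀ i, ‖z i‖ < 1) →
        Summable fun p : ℕ × (Fin n → ℕ) =>
          ‖(w ^ p.1 * mono p.2 z) • a (Fin.consEquiv (fun _ => ℕ) p)‖ := fun w z hw hz => by
      have := (Fin.consEquiv (fun _ => ℕ)).summable_iff.2 (hs _ (hb w z hw hz))
      exact this.congr fun p => by simp only [Function.comp, e]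
    -- the slices of the series in the last `n` variables
    have slice : ∀ (z : Fin n → ℂ), (∀ i, ‖z i‖ < 1) → ∀ m : ℕ,
        Summable fun l : Fin n → ℕ => ‖mono l z • a (Fin.consEquiv (fun _ => ℕ) (m, l))‖ :=
      fun z hz m => by
        have h2 : ‖(2⁻¹ : ℂ)‖ < 1 := by norm_num
        have h := ((hS 2⁻¹ z h2 hz).prod_factor m).mul_left (‖(2⁻¹ : ℂ) ^ m‖⁻¹)
        refine h.congr fun l => ?_
        simp only [mul_smul, norm_smul]
        rw [inv_mul_cancel_left₀]
        simp
    have hm : ∀ (z : Fin n → ℂ), (∀ i, ‖z i‖ < 1) → ∀ m : ℕ,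
        ∑' l : Fin n → ℕ, mono l z • a (Fin.consEquiv (fun _ => ℕ) (m, l)) = 0 := by
      intro z hz
      refine eq_zero_one _ ?_ ?_
      · intro w hw
        have h := (hS w z hw hz).prod
        refine Summable.of_nonneg_of_le (fun _ => norm_nonneg _) (fun m => ?_) h
        rw [← (slice z hz m).of_norm.tsum_const_smul]
        simp only [smul_smul]
        exact norm_tsum_le_tsum_norm ((hS w z hw hz).prod_factor m)
      · intro w hw
        have h := h0 _ (hb w z hw hz)
        rw [← (Fin.consEquiv (fun _ => ℕ)).tsum_eq] at h
        simp only [e] at h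
        rw [(hS w z hw hz).of_norm.tsum_prod] at h
        rw [← h]
        refine tsum_congr fun m => ?_
        rw [← (slice z hz m).of_norm.tsum_const_smul]
        simp only [smul_smul]
    have := ih (fun l => a (Fin.consEquiv (fun _ => ℕ) (k 0, l)))
      (fun z hz => slice z hz (k 0)) (fun z hz => hm z hz (k 0)) (fun i => k i.succ)
    have hk : Fin.consEquiv (fun _ => ℕ) (k 0, fun i => k i.succ) = k := Fin.cons_self_tail k
    rwa [hk] at this

end Monomial

/-! ### Hardy spaces -/

section Hardy

variable (n : ℕ) (E F : Type*) [NormedAddCommGroup E] [InnerProductSpace ℂ E]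
  [NormedAddCommGroup F] [InnerProductSpace ℂ F]

/-- The `E`-valued Hardy space over the disc, normed by the Taylor coefficients. Its elements are
used as functions `𝔻 → E` (see `HardyDisc.apply_eq`); it is the reproducing kernel Hilbert space
with kernel `(1 - z w̄)⁻¹ I` (see `HardyDisc.kernel_eq`). -/
def HardyDisc : Type _ := lp (fun _ : ℕ => E) 2

/-- The `E`-valued Hardy space over the polydisc `𝔻ⁿ`, normed by the Taylor coefficients. Its
elements are used as functions `𝔻ⁿ → E` (see `HardyPoly.apply_eq`); it is the reproducing kernel
Hilbert space with the Szegő kernel `∏ᵢ (1 - zᵢ w̄ᵢ)⁻¹ I` (see `HardyPoly.kernel_eq`). -/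
def HardyPoly : Type _ := lp (fun _ : Fin n → ℕ => E) 2

instance : NormedAddCommGroup (HardyDisc E) :=
  inferInstanceAs (NormedAddCommGroup (lp (fun _ : ℕ => E) 2))
instance : InnerProductSpace ℂ (HardyDisc E) :=
  inferInstanceAs (InnerProductSpace ℂ (lp (fun _ : ℕ => E) 2))
instance [CompleteSpace E] : CompleteSpace (HardyDisc E) :=
  inferInstanceAs (CompleteSpace (lp (fun _ : ℕ => E) 2))

instance : NormedAddCommGroup (HardyPoly n E) :=
  inferInstanceAs (NormedAddCommGroup (lp (fun _ : Fin n → ℕ => E) 2))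
instance : InnerProductSpace ℂ (HardyPoly n E) :=
  inferInstanceAs (InnerProductSpace ℂ (lp (fun _ : Fin n → ℕ => E) 2))
instance [CompleteSpace E] : CompleteSpace (HardyPoly n E) :=
  inferInstanceAs (CompleteSpace (lp (fun _ : Fin n → ℕ => E) 2))

variable {n E F}

/-- The Taylor coefficients. -/
def HardyDisc.coeff (f : HardyDisc E) : ℕ → E := (show lp (fun _ : ℕ => E) 2 from f)

/-- The Taylor coefficients. -/
def HardyPoly.coeff (f : HardyPoly n E) : (Fin n → ℕ) → E :=
  (show lp (fun _ : Fin n → ℕ => E) 2 from f)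

theorem HardyDisc.summable_sq (w : ℂ) (hw : ‖w‖ < 1) : Summable fun k : ℕ => ‖w ^ k‖ ^ 2 := by
  have : ‖w‖ ^ 2 < 1 := by nlinarith [norm_nonneg w]
  refine (summable_geometric_of_lt_one (sq_nonneg ‖w‖) this).congr fun k => ?_
  rw [norm_pow, ← pow_mul, ← pow_mul, mul_comm]

theorem HardyPoly.summable_sq (z : Fin n → ℂ) (hz : ∀ i, ‖z i‖ < 1) :
    Summable fun k : Fin n → ℕ => ‖Monomial.mono k z‖ ^ 2 := by
  refine (Monomial.summable_hasSum n (fun i => z i ^ 2) (fun i => ?_)).1.congr fun k => ?_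
  · rw [norm_pow]
    nlinarith [norm_nonneg (z i), hz i]
  · rw [← norm_pow, Monomial.mono, Monomial.mono, ← Finset.prod_pow]
    simp only [← pow_mul, mul_comm]

variable [CompleteSpace E] [CompleteSpace F]

instance : RKHS ℂ (HardyDisc E) 𝔻 E where
  coeCLM := .pi fun w : 𝔻 =>
    CoeffSpace.evalCLM (fun k => (w : ℂ) ^ k) (HardyDisc.summable_sq w w.norm_lt_one)
  coeCLM_injective := by
    refine (injective_iff_map_eq_zero _).mpr fun f h => lp.ext (funext fun k => ?_)
    refine Monomial.eq_zero_one _ (fun w hw => ?_) (fun w hw => ?_) k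
    · exact CoeffSpace.summable_smul _ (HardyDisc.summable_sq w hw) f
    · exact congrFun h (Complex.UnitDisc.mk w hw)

instance : RKHS ℂ (HardyPoly n E) (Fin n → 𝔻) E where
  coeCLM := .pi fun z : Fin n → 𝔻 =>
    CoeffSpace.evalCLM (fun k => Monomial.mono k fun i => (z i : ℂ))
      (HardyPoly.summable_sq _ fun i => (z i).norm_lt_one)
  coeCLM_injective := by
    refine (injective_iff_map_eq_zero _).mpr fun f h => lp.ext (funext fun k => ?_)
    refine Monomial.eq_zero n _ (fun z hz => ?_) (fun z hz => ?_) k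
    · exact CoeffSpace.summable_smul _ (HardyPoly.summable_sq z hz) f
    · exact congrFun h fun i => Complex.UnitDisc.mk (z i) (hz i)

theorem HardyDisc.apply_eq (f : HardyDisc E) (w : 𝔻) : f w = ∑' k, (w : ℂ) ^ k • f.coeff k := rfl

theorem HardyPoly.apply_eq (f : HardyPoly n E) (z : Fin n → 𝔻) :
    f z = ∑' k, (∏ i, (z i : ℂ) ^ k i) • f.coeff k := rfl

theorem HardyDisc.kernel_eq (z w : 𝔻) :
    RKHS.kernel (HardyDisc E) z w =
      (1 - (z : ℂ) * (starRingEnd ℂ) w)⁻¹ • ContinuousLinearMap.id ℂ E := by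
  ext v
  rw [← RKHS.kerFun_apply]
  have h : ‖(z : ℂ) * (starRingEnd ℂ) w‖ < 1 := by
    rw [norm_mul, RCLike.norm_conj]
    nlinarith [z.norm_lt_one, w.norm_lt_one, norm_nonneg (z : ℂ), norm_nonneg (w : ℂ)]
  refine Eq.trans ?_ ((hasSum_geometric_of_norm_lt_one h).smul_const v).tsum_eq
  refine tsum_congr fun k => ?_
  change (z : ℂ) ^ k • ((CoeffSpace.evalCLM (fun k => (w : ℂ) ^ k)
    (HardyDisc.summable_sq w w.norm_lt_one)).adjoint v) k = _
  rw [CoeffSpace.adjoint_evalCLM_apply, smul_smul, map_pow, mul_pow]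

theorem HardyPoly.kernel_eq (z w : Fin n → 𝔻) :
    RKHS.kernel (HardyPoly n E) z w =
      (∏ i, (1 - (z i : ℂ) * (starRingEnd ℂ) (w i : ℂ))⁻¹) • ContinuousLinearMap.id ℂ E := by
  ext v
  rw [← RKHS.kerFun_apply]
  have h : ∀ i, ‖(z i : ℂ) * (starRingEnd ℂ) (w i : ℂ)‖ < 1 := fun i => by
    rw [norm_mul, RCLike.norm_conj]
    nlinarith [(z i).norm_lt_one, (w i).norm_lt_one, norm_nonneg (z i : ℂ), norm_nonneg (w i : ℂ)]
  refine Eq.trans ?_ ((Monomial.summable_hasSum n _ h).2.smul_const v).tsum_eq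
  refine tsum_congr fun k => ?_
  change Monomial.mono k (fun i => (z i : ℂ)) •
    ((CoeffSpace.evalCLM (fun k => Monomial.mono k fun i => (w i : ℂ))
      (HardyPoly.summable_sq _ fun i => (w i).norm_lt_one)).adjoint v) k = _
  rw [CoeffSpace.adjoint_evalCLM_apply, smul_smul, Monomial.mono, Monomial.mono, Monomial.mono,
    map_prod, ← Finset.prod_mul_distrib]
  simp only [map_pow, mul_pow]

end Hardy

/-! ### Multiplication operators -/

section Multiplier

variable {X E F H K : Type*} [NormedAddCommGroup E] [InnerProductSpace ℂ E]
  [NormedAddCommGroup F] [InnerProductSpace ℂ F]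
  [NormedAddCommGroup H] [InnerProductSpace ℂ H] [RKHS ℂ H X E]
  [NormedAddCommGroup K] [InnerProductSpace ℂ K] [RKHS ℂ K X F]

variable (H K) in
/-- Pointwise multiplication by `φ` is a bounded operator from `H` to `K`. -/
def IsMultiplier (φ : X → E →L[ℂ] F) : Prop :=
  ∃ T : H →L[ℂ] K, ∀ (f : H) (x : X), T f x = φ x (f x)

open Classical in
variable (H K) in
/-- The operator `M_φ : H → K`, `(M_φ f)(x) = φ(x) f(x)`, of a multiplier `φ`
(the zero operator if `φ` is not a multiplier). -/
def mulOp (φ : X → E →L[ℂ] F) : H →L[ℂ] K :=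
  if h : IsMultiplier H K φ then h.choose else 0

theorem mulOp_apply {φ : X → E →L[ℂ] F} (h : IsMultiplier H K φ) (f : H) (x : X) :
    mulOp H K φ f x = φ x (f x) := by
  rw [mulOp, dif_pos h]
  exact h.choose_spec f x

theorem mulOp_unique {φ : X → E →L[ℂ] F} (T : H →L[ℂ] K) (hT : ∀ f x, T f x = φ x (f x)) :
    mulOp H K φ = T := by
  exact ContinuousLinearMap.ext fun f => RKHS.ext fun x => by rw [mulOp_apply ⟨T, hT⟩, hT]

end Multiplier

section Shifts

variable {n : ℕ} {E F : Type*} [NormedAddCommGroup E] [InnerProductSpace ℂ E] [CompleteSpace E]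
  [NormedAddCommGroup F] [InnerProductSpace ℂ F] [CompleteSpace F]

variable (E) in
/-- Multiplication by `z` on the Hardy space over the disc. -/
def Mz : HardyDisc E →L[ℂ] HardyDisc E :=
  mulOp (HardyDisc E) (HardyDisc E) fun w => (w : ℂ) • ContinuousLinearMap.id ℂ E

variable (E) in
/-- Multiplication by the coordinate `zᵢ` on the Hardy space over the polydisc. -/
def Mcoord (i : Fin n) : HardyPoly n E →L[ℂ] HardyPoly n E :=
  mulOp (HardyPoly n E) (HardyPoly n E) fun z => (z i : ℂ) • ContinuousLinearMap.id ℂ E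

variable (E) in
/-- The constant function `κᵢ(w) = M_{zᵢ}` on the disc. -/
def kappa (i : Fin n) : 𝔻 → HardyPoly n E →L[ℂ] HardyPoly n E := fun _ => Mcoord E i

variable (E) in
/-- Multiplication by `κᵢ`. -/
def Mkappa (i : Fin n) : HardyDisc (HardyPoly n E) →L[ℂ] HardyDisc (HardyPoly n E) :=
  mulOp _ _ (kappa E i)

theorem isMultiplier_z :
    IsMultiplier (HardyDisc E) (HardyDisc E)
      fun w : 𝔻 => (w : ℂ) • ContinuousLinearMap.id ℂ E :=
  ⟨CoeffSpace.push Nat.succ Nat.succ_injective, fun f w =>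
    CoeffSpace.evalCLM_push _ (HardyDisc.summable_sq w w.norm_lt_one) _ _ _
      (fun k => pow_succ' _ k) f⟩

theorem isMultiplier_coord (i : Fin n) :
    IsMultiplier (HardyPoly n E) (HardyPoly n E)
      fun z : Fin n → 𝔻 => (z i : ℂ) • ContinuousLinearMap.id ℂ E :=
  ⟨CoeffSpace.push (fun k => k + Pi.single i 1) (add_left_injective _), fun f z =>
    CoeffSpace.evalCLM_push _ (HardyPoly.summable_sq _ fun i => (z i).norm_lt_one) _ _ _
      (fun k => by
        simp only [Monomial.mono, Pi.add_apply, pow_add, Finset.prod_mul_distrib]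
        rw [mul_comm, Finset.prod_eq_single i (by intro j _ hj; simp [hj]) (by simp)]
        simp) f⟩

theorem isMultiplier_const (T : E →L[ℂ] F) :
    IsMultiplier (HardyDisc E) (HardyDisc F) fun _ : 𝔻 => T :=
  ⟨CoeffSpace.mapCoeff T, fun f w =>
    CoeffSpace.evalCLM_mapCoeff _ (HardyDisc.summable_sq w w.norm_lt_one) T f⟩

theorem Mz_apply (f : HardyDisc E) (w : 𝔻) : Mz E f w = (w : ℂ) • f w :=
  mulOp_apply isMultiplier_z f w

theorem Mcoord_apply (i : Fin n) (f : HardyPoly n E) (z : Fin n → 𝔻) :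
    Mcoord E i f z = (z i : ℂ) • f z :=
  mulOp_apply (isMultiplier_coord i) f z

theorem Mkappa_apply (i : Fin n) (f : HardyDisc (HardyPoly n E)) (w : 𝔻) :
    Mkappa E i f w = Mcoord E i (f w) :=
  mulOp_apply (isMultiplier_const _) f w

end Shifts

/-! ### Bounded analytic functions, inner functions, shifts -/

section Inner

variable {E F : Type*} [NormedAddCommGroup E] [InnerProductSpace ℂ E] [CompleteSpace E]
  [NormedAddCommGroup F] [InnerProductSpace ℂ F] [CompleteSpace F]

/-- Bounded analytic operator-valued functions on the disc. -/
def IsBoundedAnalytic (φ : 𝔻 → E →L[ℂ] F) : Prop :=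
  (∃ g : ℂ → E →L[ℂ] F, DifferentiableOn ℂ g (Metric.ball 0 1) ∧ ∀ w : 𝔻, φ w = g w) ∧
    ∃ C : ℝ, ∀ w, ‖φ w‖ ≤ C

/-- Inner functions: bounded analytic functions whose multiplication operator between the Hardy
spaces is an isometry. -/
def IsInner (φ : 𝔻 → E →L[ℂ] F) : Prop :=
  IsBoundedAnalytic φ ∧ IsMultiplier (HardyDisc E) (HardyDisc F) φ ∧
    ∀ f, ‖mulOp (HardyDisc E) (HardyDisc F) φ f‖ = ‖f‖

/-- A shift is a pure isometry. -/
def IsShift (V : E →L[ℂ] E) : Prop :=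
  (∀ f, ‖V f‖ = ‖f‖) ∧ ∀ f, Tendsto (fun m : ℕ => ‖(V.adjoint ^ m) f‖) atTop (𝓝 0)

/-- The wandering subspace `W = S ⊖ zS`. -/
def wandering (S : ClosedSubmodule ℂ (HardyDisc E)) : Submodule ℂ (HardyDisc E) :=
  S.toSubmodule ⊓ (S.toSubmodule.map (Mz E).toLinearMap)ᗮ

instance (S : ClosedSubmodule ℂ (HardyDisc E)) : CompleteSpace (wandering S) :=
  (S.isClosed.inter (Submodule.isClosed_orthogonal _)).completeSpace_coe

/-- The Beurling-Lax-Halmos function `Θ : 𝔻 → B(W, E)` of `S`, `Θ(w) η = η(w)`: multiplication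
by it takes the constant function `η` of the `W`-valued Hardy space to `η`. -/
def blh (S : ClosedSubmodule ℂ (HardyDisc E)) : 𝔻 → wandering S →L[ℂ] E := fun w =>
  (ContinuousLinearMap.proj w ∘L RKHS.coeCLM ℂ) ∘L (wandering S).subtypeL

theorem blh_apply (S : ClosedSubmodule ℂ (HardyDisc E)) (w : 𝔻) (η : wandering S) :
    blh S w η = (η : HardyDisc E) w := rfl

/-- `P_W M_Θ (I - w M_z^*)⁻¹ M_Θ^* A |_W`. -/
def compressed (S : ClosedSubmodule ℂ (HardyDisc E)) (Θ : 𝔻 → wandering S →L[ℂ] E)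
    (A : HardyDisc E →L[ℂ] HardyDisc E) : 𝔻 → wandering S →L[ℂ] wandering S := fun w =>
  (wandering S).orthogonalProjectionOnto ∘L mulOp (HardyDisc (wandering S)) (HardyDisc E) Θ ∘L
    Ring.inverse (1 - (w : ℂ) • (Mz (wandering S)).adjoint) ∘L
    (mulOp (HardyDisc (wandering S)) (HardyDisc E) Θ).adjoint ∘L A ∘L (wandering S).subtypeL

end Inner

end

noncomputable section

/-! ### Pure isometries -/

section PureIsometry

variable {H : Type*} [NormedAddCommGroup H] [InnerProductSpace ℂ H] [CompleteSpace H]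

/-! Everything is carried over from `S` to the Hardy space of `W = wandering S` by one isometry.
Since `M_z` is isometric, the spaces `z ^ k W` are mutually orthogonal; a vector of `S` orthogonal
to all of them is divisible by every power of `z`, hence zero. So `f ↦ ∑ z ^ k f_k` maps onto `S`
(`range_woldIsometry`), and evaluating it pointwise identifies it with `M_Θ` (`woldIsometry_apply`).
Hence `Θ` is inner, and `M_Θ M_Θ^*` is the identity on `S`.

The formula for `Φ_i` is a disguised evaluation. Because `(1 - w̄ M_z) k_w v = v`, pairing it with
`v ∈ W` gives `Φ_i(w) η = (M_Θ^* M_{κ_i} η)(w)` (`compressed_blh_apply`). If `S` is invariant under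
`M_{κ_i}`, then `M_Θ^* M_{κ_i} M_Θ` commutes with `M_z`, so it is multiplication by its symbol
`Φ_i`, and `M_Θ` intertwines it with `M_{κ_i}`. The `M_{κ_i}` are commuting shifts, and both
properties descend along an intertwining isometry. Conversely, `κ_i Θ = Θ Φ_i` gives `M_{κ_i} M_Θ g
= M_Θ M_{Φ_i} g ∈ S`. The unitary is `M_Θ^*` on `S`. -/

theorem norm_adjoint_pow_apply_le {V : H →L[ℂ] H} (hV : ∀ f, ‖V f‖ = ‖f‖) (m : ℕ) (f : H) :
    ‖(V.adjoint ^ m) f‖ ≤ ‖f‖ := by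
  induction m with
  | zero => simp
  | succ m ih =>
    rw [pow_succ', mul_apply_eq_comp]
    refine le_trans (le_trans (V.adjoint.le_opNorm _) ?_) ih
    refine mul_le_of_le_one_left (norm_nonneg _) ?_
    rw [LinearIsometryEquiv.norm_map]
    exact V.opNorm_le_bound zero_le_one fun f => by rw [hV, one_mul]

/-- A convergent sum of vectors on which the powers of the adjoint of an isometry tend to zero is
again such a vector. -/
theorem tendsto_adjoint_pow_of_hasSum {ι : Type*} {V : H →L[ℂ] H} (hV : ∀ f, ‖V f‖ = ‖f‖)
    {x : ι → H} {f : H} (hx : HasSum x f)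
    (h : ∀ i, Tendsto (fun m : ℕ => ‖(V.adjoint ^ m) (x i)‖) atTop (𝓝 0)) :
    Tendsto (fun m : ℕ => ‖(V.adjoint ^ m) f‖) atTop (𝓝 0) := by
  have hfin : ∀ s : Finset ι,
      Tendsto (fun m : ℕ => ‖(V.adjoint ^ m) (∑ i ∈ s, x i)‖) atTop (𝓝 0) := fun s => by
    have h0 : Tendsto (fun m : ℕ => ∑ i ∈ s, ‖(V.adjoint ^ m) (x i)‖) atTop (𝓝 0) := by
      have := tendsto_finsetSum s fun i _ => h i
      rwa [Finset.sum_const_zero] at this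
    refine squeeze_zero (fun _ => norm_nonneg _) (fun m => ?_) h0
    rw [map_sum]
    exact norm_sum_le _ _
  rw [Metric.tendsto_atTop]
  intro ε hε
  have hx' : Tendsto (fun s : Finset ι => ∑ i ∈ s, x i) atTop (𝓝 f) := by
    simpa only [HasSum, SummationFilter.unconditional_filter] using hx
  obtain ⟨s, h1⟩ := ((Metric.tendsto_nhds.1 hx') (ε / 2) (half_pos hε)).exists
  obtain ⟨N, hN⟩ := (Metric.tendsto_atTop.1 (hfin s)) (ε / 2) (half_pos hε)
  refine ⟨N, fun m hm => ?_⟩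
  have h2 := hN m hm
  have h3 := norm_adjoint_pow_apply_le hV m (f - ∑ i ∈ s, x i)
  rw [dist_comm, dist_eq_norm] at h1
  rw [dist_zero_right, norm_norm] at h2 ⊢
  have h4 : (V.adjoint ^ m) f =
      (V.adjoint ^ m) (f - ∑ i ∈ s, x i) + (V.adjoint ^ m) (∑ i ∈ s, x i) := by
    rw [← map_add, sub_add_cancel]
  rw [h4]
  linarith [norm_add_le ((V.adjoint ^ m) (f - ∑ i ∈ s, x i)) ((V.adjoint ^ m) (∑ i ∈ s, x i))]

theorem inner_adjoint_pow (V : H →L[ℂ] H) (m : ℕ) (f g : H) :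
    ⟪(V.adjoint ^ m) f, g⟫_ℂ = ⟪f, (V ^ m) g⟫_ℂ := by
  induction m generalizing f with
  | zero => simp
  | succ m ih =>
    rw [pow_succ, mul_apply_eq_comp, ih, ContinuousLinearMap.adjoint_inner_left,
      pow_succ', mul_apply_eq_comp]

end PureIsometry

namespace CoeffSpace

variable {κ E F : Type*} [NormedAddCommGroup E] [InnerProductSpace ℂ E]
  [NormedAddCommGroup F] [InnerProductSpace ℂ F]

theorem push_apply_self (σ : κ → κ) (hσ : Function.Injective σ) (f : lp (fun _ : κ => E) 2)
    (k : κ) : push σ hσ f (σ k) = f k :=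
  hσ.extend_apply _ _ _

theorem push_apply_of_notMem (σ : κ → κ) (hσ : Function.Injective σ)
    (f : lp (fun _ : κ => E) 2) {k : κ} (hk : k ∉ Set.range σ) : push σ hσ f k = 0 :=
  Function.extend_apply' _ _ _ hk

theorem norm_push (σ : κ → κ) (hσ : Function.Injective σ) (f : lp (fun _ : κ => E) 2) :
    ‖push σ hσ f‖ = ‖f‖ := by
  rw [← sq_eq_sq₀ (norm_nonneg _) (norm_nonneg _), norm_sq, norm_sq, ← hσ.tsum_eq]
  · simp only [push_apply_self]
  · intro k hk
    by_contra hk'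
    exact hk (by simp [push_apply_of_notMem σ hσ f hk'])

theorem push_pow_apply_of_notMem (σ : κ → κ) (hσ : Function.Injective σ) (m : ℕ)
    (f : lp (fun _ : κ => E) 2) {k : κ} (hk : k ∉ Set.range σ^[m]) :
    (push σ hσ ^ m) f k = 0 := by
  induction m generalizing k with
  | zero => simp at hk
  | succ m ih =>
    rw [pow_succ', mul_apply_eq_comp]
    by_cases h : k ∈ Set.range σ
    · obtain ⟨j, rfl⟩ := h
      rw [push_apply_self]
      refine ih ?_
      rintro ⟨l, rfl⟩
      exact hk ⟨l, Function.iterate_succ_apply' _ _ _⟩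
    · exact push_apply_of_notMem _ _ _ h

theorem hasSum_single [DecidableEq κ] (f : lp (fun _ : κ => E) 2) :
    HasSum (fun k => lp.single 2 k (f k)) f :=
  lp.hasSum_single (E := fun _ : κ => E) (p := 2) (by norm_num) f

theorem tendsto_adjoint_pow_of_single [CompleteSpace E] [DecidableEq κ]
    {V : lp (fun _ : κ => E) 2 →L[ℂ] lp (fun _ : κ => E) 2} (hV : ∀ f, ‖V f‖ = ‖f‖)
    (h : ∀ k v, Tendsto (fun m : ℕ => ‖(V.adjoint ^ m) (lp.single 2 k v)‖) atTop (𝓝 0))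
    (f : lp (fun _ : κ => E) 2) :
    Tendsto (fun m : ℕ => ‖(V.adjoint ^ m) f‖) atTop (𝓝 0) :=
  tendsto_adjoint_pow_of_hasSum hV (hasSum_single f) fun k => h k (f k)

/-- Pairing with the `m`-th power shows that the `m`-th power of the adjoint kills a vector
supported at `k` once `k` has left the range of `σ^[m]`. On such vectors the sequence of norms is
eventually zero, and they span a dense subspace. -/
theorem isShift_push [CompleteSpace E] (σ : κ → κ) (hσ : Function.Injective σ)
    (h : ∀ k, ∃ N, ∀ m ≥ N, k ∉ Set.range σ^[m]) :
    IsShift (push (E := E) σ hσ) := by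
  classical
  refine ⟨norm_push σ hσ, tendsto_adjoint_pow_of_single (norm_push σ hσ) fun k v => ?_⟩
  obtain ⟨N, hN⟩ := h k
  refine tendsto_const_nhds.congr' ?_
  filter_upwards [eventually_ge_atTop N] with m hm
  symm
  rw [norm_eq_zero]
  refine ext_inner_right ℂ fun g => ?_
  rw [inner_adjoint_pow, lp.inner_single_left, push_pow_apply_of_notMem _ _ _ _ (hN m hm)]
  simp

theorem mapCoeff_apply (T : E →L[ℂ] F) (f : lp (fun _ : κ => E) 2) (k : κ) :
    mapCoeff T f k = T (f k) := rfl

theorem mapCoeff_pow_apply (T : E →L[ℂ] E) (m : ℕ) (f : lp (fun _ : κ => E) 2) (k : κ) :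
    (mapCoeff T ^ m) f k = (T ^ m) (f k) := by
  induction m with
  | zero => simp
  | succ m ih =>
    rw [pow_succ', mul_apply_eq_comp, mapCoeff_apply, ih, pow_succ',
      mul_apply_eq_comp]

theorem norm_mapCoeff {T : E →L[ℂ] F} (hT : ∀ v, ‖T v‖ = ‖v‖) (f : lp (fun _ : κ => E) 2) :
    ‖mapCoeff T f‖ = ‖f‖ := by
  rw [← sq_eq_sq₀ (norm_nonneg _) (norm_nonneg _), norm_sq, norm_sq]
  simp only [mapCoeff_apply, hT]

/-- The adjoint acts by `T.adjoint` on each coefficient, so purity on vectors supported at a single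
index is purity of `T`. -/
theorem isShift_mapCoeff [CompleteSpace E] {T : E →L[ℂ] E} (hT : IsShift T) :
    IsShift (mapCoeff (κ := κ) T) := by
  classical
  refine ⟨norm_mapCoeff hT.1, tendsto_adjoint_pow_of_single (norm_mapCoeff hT.1) fun k v => ?_⟩
  refine (hT.2 v).congr fun m => ?_
  have : ((mapCoeff T).adjoint ^ m) (lp.single 2 k v) =
      lp.single 2 k ((T.adjoint ^ m) v) := by
    refine ext_inner_right ℂ fun g => ?_
    rw [inner_adjoint_pow, lp.inner_single_left, lp.inner_single_left, mapCoeff_pow_apply,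
      inner_adjoint_pow]
  rw [this, lp.norm_single (by norm_num)]

end CoeffSpace

/-! ### Coefficients and monomials in the Hardy space of the disc -/

namespace HardyDisc

variable {E : Type*} [NormedAddCommGroup E] [InnerProductSpace ℂ E]

/-- The function `z ↦ z ^ k • v`. -/
def monomial (k : ℕ) (v : E) : HardyDisc E :=
  (show HardyDisc E from (lp.single 2 k v : lp (fun _ : ℕ => E) 2))

theorem hasSum_monomial (f : HardyDisc E) : HasSum (fun k => monomial k (f.coeff k)) f :=
  lp.hasSum_single (E := fun _ : ℕ => E) (p := 2) (by norm_num) f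

theorem coeff_injective : Function.Injective (coeff : HardyDisc E → ℕ → E) :=
  fun _ _ h => lp.ext h

theorem norm_coeff_le (f : HardyDisc E) (k : ℕ) : ‖f.coeff k‖ ≤ ‖f‖ :=
  lp.norm_apply_le_norm (E := fun _ : ℕ => E) (p := 2) (by norm_num) f k

/-- The `k`-th Taylor coefficient as a bounded operator. -/
def coeffCLM (k : ℕ) : HardyDisc E →L[ℂ] E :=
  LinearMap.mkContinuous
    { toFun := fun f => f.coeff k
      map_add' := fun _ _ => rfl
      map_smul' := fun _ _ => rfl } 1 fun f => by rw [one_mul]; exact norm_coeff_le f k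

theorem norm_coeffCLM_le (k : ℕ) : ‖(coeffCLM k : HardyDisc E →L[ℂ] E)‖ ≤ 1 :=
  LinearMap.mkContinuous_norm_le _ zero_le_one _

variable [CompleteSpace E]

theorem hasSum_apply (f : HardyDisc E) (w : 𝔻) :
    HasSum (fun k => (w : ℂ) ^ k • f.coeff k) (f w) :=
  (CoeffSpace.summable_smul _ (summable_sq w w.norm_lt_one) f).of_norm.hasSum

theorem monomial_apply (k : ℕ) (v : E) (w : 𝔻) : monomial k v w = (w : ℂ) ^ k • v := by
  rw [apply_eq, tsum_eq_single k]
  · congr 1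
    exact lp.single_apply_self (E := fun _ : ℕ => E) 2 k v
  · intro j hj
    have : (monomial k v).coeff j = 0 := lp.single_apply_ne (E := fun _ : ℕ => E) 2 k v hj
    rw [this, smul_zero]

theorem Mz_eq_push : Mz E = CoeffSpace.push (E := E) Nat.succ Nat.succ_injective :=
  mulOp_unique (H := HardyDisc E) (K := HardyDisc E) _ fun f w =>
    CoeffSpace.evalCLM_push _ (HardyDisc.summable_sq w w.norm_lt_one) _ _ _
      (fun k => pow_succ' _ k) f

theorem norm_Mz (f : HardyDisc E) : ‖Mz E f‖ = ‖f‖ := by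
  rw [Mz_eq_push]
  exact CoeffSpace.norm_push _ _ _

theorem norm_Mz_pow (k : ℕ) (f : HardyDisc E) : ‖(Mz E ^ k) f‖ = ‖f‖ := by
  induction k with
  | zero => simp
  | succ k ih => rw [pow_succ', mul_apply_eq_comp, norm_Mz, ih]

/-- This makes divisibility by all powers of `z` force a function to vanish, the purity used in the
Wold decomposition. -/
theorem coeff_Mz_pow_of_lt {k j : ℕ} (hj : j < k) (f : HardyDisc E) :
    ((Mz E ^ k) f).coeff j = 0 := by
  rw [Mz_eq_push]
  refine CoeffSpace.push_pow_apply_of_notMem _ _ k f ?_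
  rintro ⟨l, hl⟩
  rw [Nat.succ_iterate] at hl
  omega

theorem Mz_pow_apply (k : ℕ) (f : HardyDisc E) (w : 𝔻) :
    (Mz E ^ k) f w = (w : ℂ) ^ k • f w := by
  induction k with
  | zero => simp
  | succ k ih => rw [pow_succ', mul_apply_eq_comp, Mz_apply, ih, smul_smul, pow_succ']

theorem Mz_pow_monomial_zero (k : ℕ) (v : E) : (Mz E ^ k) (monomial 0 v) = monomial k v :=
  RKHS.ext (𝕜 := ℂ) fun w => by rw [Mz_pow_apply, monomial_apply, monomial_apply]; simp

theorem inner_Mz_pow (k : ℕ) (f g : HardyDisc E) :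
    ⟪(Mz E ^ k) f, (Mz E ^ k) g⟫_ℂ = ⟪f, g⟫_ℂ :=
  LinearIsometry.inner_map_map (𝕜 := ℂ) ⟨(Mz E ^ k).toLinearMap, norm_Mz_pow k⟩ f g

theorem norm_kerFun_sq (w : 𝔻) (v : E) :
    ‖RKHS.kerFun (HardyDisc E) w v‖ ^ 2 = (1 - ‖(w : ℂ)‖ ^ 2)⁻¹ * ‖v‖ ^ 2 := by
  have h : ⟪RKHS.kerFun (HardyDisc E) w v, RKHS.kerFun (HardyDisc E) w v⟫_ℂ =
      ((1 - ‖(w : ℂ)‖ ^ 2)⁻¹ * ‖v‖ ^ 2 : ℝ) := by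
    rw [RKHS.kerFun_inner, RKHS.kerFun_apply, kernel_eq, Complex.mul_conj, Complex.normSq_eq_norm_sq]
    simp [inner_smul_right, inner_self_eq_norm_sq_to_K]
  rw [inner_self_eq_norm_sq_to_K] at h
  exact Complex.ofReal_injective (by simpa using h)

/-- `(1 - w̄ M_z) k_w v = v`. -/
theorem kerFun_sub_smul_Mz (w : 𝔻) (v : E) :
    RKHS.kerFun (HardyDisc E) w v -
      (starRingEnd ℂ) (w : ℂ) • Mz E (RKHS.kerFun (HardyDisc E) w v) = monomial 0 v := by
  refine RKHS.ext (𝕜 := ℂ) fun z => ?_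
  have h : (1 - (z : ℂ) * (starRingEnd ℂ) w) ≠ 0 := by
    intro h
    have h1 : ‖(z : ℂ) * (starRingEnd ℂ) (w : ℂ)‖ = 1 := by
      rw [← sub_eq_zero.1 h, norm_one]
    rw [norm_mul, RCLike.norm_conj] at h1
    nlinarith [z.norm_lt_one, w.norm_lt_one, norm_nonneg (z : ℂ), norm_nonneg (w : ℂ)]
  rw [RKHS.coe_sub (𝕜 := ℂ), Pi.sub_apply, RKHS.coe_smul (𝕜 := ℂ), Pi.smul_apply, Mz_apply,
    RKHS.kerFun_apply, kernel_eq, monomial_apply]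
  simp only [smul_apply, ContinuousLinearMap.id_apply, smul_smul, ← sub_smul,
    pow_zero]
  congr 1
  field_simp

end HardyDisc

/-! ### The coordinate shifts -/

section CoordinateShifts

variable {n : ℕ} {E : Type*} [NormedAddCommGroup E] [InnerProductSpace ℂ E] [CompleteSpace E]

theorem isShift_Mcoord (i : Fin n) : IsShift (Mcoord E i) := by
  have h : Mcoord E i = CoeffSpace.push (E := E) (fun k : Fin n → ℕ => k + Pi.single i 1)
      (add_left_injective _) :=
    mulOp_unique (H := HardyPoly n E) (K := HardyPoly n E) _ fun f z =>
      CoeffSpace.evalCLM_push _ (HardyPoly.summable_sq _ fun i => (z i).norm_lt_one) _ _ _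
        (fun k => by
          simp only [Monomial.mono, Pi.add_apply, pow_add, Finset.prod_mul_distrib]
          rw [mul_comm, Finset.prod_eq_single i (by intro j _ hj; simp [hj]) (by simp)]
          simp) f
  rw [h]
  -- Each step raises the `i`-th exponent by one, so after more than `k i` steps the index `k` can
  -- no longer be reached.
  refine CoeffSpace.isShift_push _ _ fun k => ⟨k i + 1, fun m hm => ?_⟩
  rintro ⟨l, hl⟩
  have h1 : ∀ m : ℕ, (fun k : Fin n → ℕ => k + Pi.single i 1)^[m] l i = l i + m := fun m => by
    induction m with
    | zero => simp
    | succ m ih => rw [Function.iterate_succ_apply', Pi.add_apply, ih]; simp [add_assoc]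
  have h2 := h1 m
  rw [hl] at h2
  omega

theorem isShift_Mkappa (i : Fin n) : IsShift (Mkappa E i) := by
  have h : Mkappa E i = CoeffSpace.mapCoeff (κ := ℕ) (Mcoord E i) :=
    mulOp_unique (H := HardyDisc (HardyPoly n E)) (K := HardyDisc (HardyPoly n E)) _ fun f w =>
      CoeffSpace.evalCLM_mapCoeff _ (HardyDisc.summable_sq w w.norm_lt_one) _ f
  rw [h]
  exact CoeffSpace.isShift_mapCoeff (isShift_Mcoord i)

theorem Mkappa_comm (i j : Fin n) (f : HardyDisc (HardyPoly n E)) :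
    Mkappa E i (Mkappa E j f) = Mkappa E j (Mkappa E i f) := by
  refine RKHS.ext (𝕜 := ℂ) fun w => RKHS.ext (𝕜 := ℂ) fun z => ?_
  simp only [Mkappa_apply, Mcoord_apply, smul_smul, mul_comm]

theorem Mkappa_Mz (i : Fin n) (f : HardyDisc (HardyPoly n E)) :
    Mkappa E i (Mz _ f) = Mz _ (Mkappa E i f) := by
  refine RKHS.ext (𝕜 := ℂ) fun w => ?_
  simp only [Mkappa_apply, Mz_apply, map_smul]

end CoordinateShifts

/-! ### Multipliers between Hardy spaces of the disc -/

section DiscMultipliers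

variable {E F : Type*} [NormedAddCommGroup E] [InnerProductSpace ℂ E] [CompleteSpace E]
  [NormedAddCommGroup F] [InnerProductSpace ℂ F] [CompleteSpace F]

/-- Evaluation at a point of the disc as a bounded operator. -/
def HardyDisc.evalCLM (w : 𝔻) : HardyDisc E →L[ℂ] E :=
  ContinuousLinearMap.proj w ∘L RKHS.coeCLM ℂ

theorem HardyDisc.evalCLM_apply (w : 𝔻) (f : HardyDisc E) : HardyDisc.evalCLM w f = f w := rfl

theorem HardyDisc.clm_ext {G : Type*} [NormedAddCommGroup G] [InnerProductSpace ℂ G]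
    {A B : HardyDisc E →L[ℂ] G}
    (h : ∀ k v, A (HardyDisc.monomial k v) = B (HardyDisc.monomial k v)) : A = B := by
  ext f
  refine (A.hasSum (HardyDisc.hasSum_monomial f)).unique ?_
  simp only [h]
  exact B.hasSum (HardyDisc.hasSum_monomial f)

/-- An operator commuting with `M_z` is the operator of multiplication by its symbol. -/
theorem apply_of_comm_Mz {A : HardyDisc E →L[ℂ] HardyDisc F}
    (hA : ∀ f, A (Mz E f) = Mz F (A f)) {φ : 𝔻 → E →L[ℂ] F}
    (hφ : ∀ w v, φ w v = A (HardyDisc.monomial 0 v) w) (f : HardyDisc E) (w : 𝔻) :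
    A f w = φ w (f w) := by
  have hpow : ∀ k f, A ((Mz E ^ k) f) = (Mz F ^ k) (A f) := fun k f => by
    induction k with
    | zero => simp
    | succ k ih => rw [pow_succ', mul_apply_eq_comp, hA, ih, pow_succ', mul_apply_eq_comp]
  -- Both sides are bounded in `f`, so it is enough to compare them on `z ^ k v`, where commutation
  -- with `M_z` reduces everything to the constant `v`.
  have h : HardyDisc.evalCLM w ∘L A = φ w ∘L HardyDisc.evalCLM w := by
    refine HardyDisc.clm_ext fun k v => ?_
    rw [ContinuousLinearMap.comp_apply, ContinuousLinearMap.comp_apply, HardyDisc.evalCLM_apply,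
      HardyDisc.evalCLM_apply, ← HardyDisc.Mz_pow_monomial_zero, hpow, HardyDisc.Mz_pow_apply,
      HardyDisc.Mz_pow_apply, map_smul, hφ, HardyDisc.monomial_apply, pow_zero, one_smul]
  exact congrArg (fun B => B f) h

/-- The symbol of a contractive multiplication operator is contractive. -/
theorem norm_symbol_le_one {φ : 𝔻 → E →L[ℂ] F} {T : HardyDisc E →L[ℂ] HardyDisc F}
    (hT : ∀ f w, T f w = φ w (f w)) (hn : ∀ f, ‖T f‖ ≤ ‖f‖) (w : 𝔻) : ‖φ w‖ ≤ 1 := by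
  -- The adjoint of a multiplication operator sends kernel functions to kernel functions. Their
  -- norms at `w` carry the same factor `(1 - |w|²)⁻¹` in both spaces, so it cancels.
  have hadj : ∀ v, T.adjoint (RKHS.kerFun (HardyDisc F) w v) =
      RKHS.kerFun (HardyDisc E) w ((φ w).adjoint v) := fun v => by
    refine ext_inner_right ℂ fun f => ?_
    rw [ContinuousLinearMap.adjoint_inner_left, RKHS.kerFun_inner, RKHS.kerFun_inner, hT,
      ContinuousLinearMap.adjoint_inner_left]
  have hT1 : ‖T.adjoint‖ ≤ 1 := by
    rw [LinearIsometryEquiv.norm_map]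
    exact T.opNorm_le_bound zero_le_one fun f => by rw [one_mul]; exact hn f
  have hw : 0 < (1 - ‖(w : ℂ)‖ ^ 2)⁻¹ := by
    have := w.norm_lt_one
    rw [inv_pos]
    nlinarith [norm_nonneg (w : ℂ)]
  rw [← LinearIsometryEquiv.norm_map ContinuousLinearMap.adjoint]
  refine ContinuousLinearMap.opNorm_le_bound _ zero_le_one fun v => ?_
  rw [one_mul]
  have h1 := T.adjoint.le_of_opNorm_le hT1 (RKHS.kerFun (HardyDisc F) w v)
  rw [one_mul, hadj] at h1
  have h2 := pow_le_pow_left₀ (norm_nonneg _) h1 2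
  rw [HardyDisc.norm_kerFun_sq, HardyDisc.norm_kerFun_sq] at h2
  exact le_of_sq_le_sq (le_of_mul_le_mul_left h2 hw) (norm_nonneg _)

/-- Power series with contractive coefficients are analytic in the disc. -/
theorem summable_and_differentiableOn_of_norm_le_one {V : Type*} [NormedAddCommGroup V]
    [NormedSpace ℂ V] [CompleteSpace V] {C : ℕ → V} (hC : ∀ k, ‖C k‖ ≤ 1) :
    (∀ w : ℂ, ‖w‖ < 1 → Summable fun k => w ^ k • C k) ∧
      DifferentiableOn ℂ (fun w : ℂ => ∑' k, w ^ k • C k) (Metric.ball 0 1) := by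
  have hle : ∀ k (w : ℂ), ‖w ^ k • C k‖ ≤ ‖w‖ ^ k := fun k w => by
    rw [norm_smul, norm_pow]
    exact mul_le_of_le_one_right (by positivity) (hC k)
  refine ⟨fun w hw => Summable.of_norm_bounded (summable_geometric_of_lt_one (norm_nonneg _) hw)
    fun k => hle k w, fun w hw => ?_⟩
  -- The geometric majorant is uniform only on discs of radius `r < 1`; differentiability at `w` is
  -- local, so one such disc around `w` suffices.
  obtain ⟨r, hwr, hr1⟩ := exists_between (mem_ball_zero_iff.1 hw)
  have hd : DifferentiableOn ℂ (fun w : ℂ => ∑' k, w ^ k • C k) (Metric.ball 0 r) := by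
    refine Complex.differentiableOn_tsum_of_summable_norm
      (summable_geometric_of_lt_one ((norm_nonneg w).trans hwr.le) hr1)
      (fun k => ?_) Metric.isOpen_ball fun k z hz => (hle k z).trans ?_
    · exact ((differentiable_id.pow k).smul_const (C k)).differentiableOn
    · exact pow_le_pow_left₀ (norm_nonneg _) (mem_ball_zero_iff.1 hz).le k
  exact (hd.differentiableAt (Metric.isOpen_ball.mem_nhds
    (mem_ball_zero_iff.2 hwr))).differentiableWithinAt

/-- Evaluation at `w` is the operator-norm convergent power series `∑ w ^ k • coeffCLM k` with
contractive coefficients. With `L` the inclusion of `W` this is the analyticity of `Θ`. -/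
theorem exists_differentiableOn_evalCLM_comp (L : E →L[ℂ] HardyDisc F) :
    ∃ g : ℂ → E →L[ℂ] F, DifferentiableOn ℂ g (Metric.ball 0 1) ∧
      ∀ w : 𝔻, HardyDisc.evalCLM w ∘L L = g w := by
  obtain ⟨hs, hd⟩ := summable_and_differentiableOn_of_norm_le_one
    (C := fun k => (HardyDisc.coeffCLM k : HardyDisc F →L[ℂ] F)) HardyDisc.norm_coeffCLM_le
  refine ⟨fun w => (∑' k, w ^ k • HardyDisc.coeffCLM k) ∘L L,
    hd.clm_comp (differentiableOn_const L), fun w => ?_⟩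
  congr 1
  ext f
  have h := (ContinuousLinearMap.apply ℂ F f).hasSum (hs w w.norm_lt_one).hasSum
  exact (HardyDisc.hasSum_apply f w).unique h

theorem isInner_of_isometry {φ : 𝔻 → E →L[ℂ] F}
    (hφ : ∃ g : ℂ → E →L[ℂ] F, DifferentiableOn ℂ g (Metric.ball 0 1) ∧ ∀ w : 𝔻, φ w = g w)
    (T : HardyDisc E →ₗᵢ[ℂ] HardyDisc F) (hT : ∀ f w, T f w = φ w (f w)) : IsInner φ := by
  refine ⟨⟨hφ, 1, norm_symbol_le_one (T := T.toContinuousLinearMap) hT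
    fun f => (T.norm_map f).le⟩, ⟨T.toContinuousLinearMap, hT⟩, fun f => ?_⟩
  rw [mulOp_unique T.toContinuousLinearMap hT]
  exact T.norm_map f

end DiscMultipliers

/-! ### The Beurling-Lax-Halmos theorem -/

section BeurlingLaxHalmos

variable {E : Type*} [NormedAddCommGroup E] [InnerProductSpace ℂ E] [CompleteSpace E]
  (S : ClosedSubmodule ℂ (HardyDisc E))

theorem mem_of_mem_wandering {η : HardyDisc E} (hη : η ∈ wandering S) : η ∈ S := hη.1

theorem inner_Mz_wandering {f η : HardyDisc E} (hf : f ∈ S) (hη : η ∈ wandering S) :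
    ⟪Mz E f, η⟫_ℂ = 0 :=
  (Submodule.mem_orthogonal _ _).1 hη.2 _ ⟨f, hf, rfl⟩

variable {S} in
theorem Mz_pow_mem (hS : ∀ f ∈ S, Mz E f ∈ S) (k : ℕ) {f : HardyDisc E} (hf : f ∈ S) :
    (Mz E ^ k) f ∈ S := by
  induction k with
  | zero => simpa using hf
  | succ k ih => rw [pow_succ', mul_apply_eq_comp]; exact hS _ ih

/-- The embedding `η ↦ z ^ k η` of the wandering subspace. -/
def wanderingPow (k : ℕ) : wandering S →ₗᵢ[ℂ] HardyDisc E where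
  toLinearMap := (Mz E ^ k).toLinearMap ∘ₗ (wandering S).subtype
  norm_map' _ := HardyDisc.norm_Mz_pow k _

theorem wanderingPow_apply (k : ℕ) (η : wandering S) :
    wanderingPow S k η = (Mz E ^ k) (η : HardyDisc E) := rfl

variable {S}

theorem orthogonalFamily_wanderingPow (hS : ∀ f ∈ S, Mz E f ∈ S) :
    OrthogonalFamily ℂ (fun _ : ℕ => wandering S) (wanderingPow S) := by
  -- After cancelling the isometry `M_z ^ j`, the gap `k + 1` leaves at least one factor `z`: an
  -- element of `zS` is paired with one of `W`.
  have h : ∀ (j k : ℕ) (η ζ : wandering S),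
      ⟪wanderingPow S (j + (k + 1)) η, wanderingPow S j ζ⟫_ℂ = 0 := fun j k η ζ => by
    rw [wanderingPow_apply, wanderingPow_apply, pow_add, mul_apply_eq_comp,
      HardyDisc.inner_Mz_pow, pow_succ', mul_apply_eq_comp]
    exact inner_Mz_wandering S (Mz_pow_mem hS k η.2.1) ζ.2
  intro i j hij η ζ
  rcases lt_or_gt_of_ne hij with hlt | hlt
  · obtain ⟨k, rfl⟩ := Nat.exists_eq_add_of_lt hlt
    rw [← inner_conj_symm, add_assoc, h, map_zero]
  · obtain ⟨k, rfl⟩ := Nat.exists_eq_add_of_lt hlt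
    rw [add_assoc, h]

/-- An element of `S` orthogonal to the wandering subspace is divisible by `z` in `S`. -/
theorem exists_Mz_eq_of_orthogonal {f : HardyDisc E} (hS : ∀ f ∈ S, Mz E f ∈ S) (hf : f ∈ S)
    (h : ∀ η ∈ wandering S, ⟪f, η⟫_ℂ = 0) : ∃ g ∈ S, Mz E g = f := by
  set R : Submodule ℂ (HardyDisc E) := S.toSubmodule.map (Mz E).toLinearMap with hR
  have hiso : Isometry (Mz E) := AddMonoidHomClass.isometry_of_norm (Mz E) HardyDisc.norm_Mz
  have hcl : IsClosed (R : Set (HardyDisc E)) := by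
    have : (R : Set (HardyDisc E)) = Mz E '' (S : Set (HardyDisc E)) := rfl
    rw [this]
    exact hiso.isClosedEmbedding.isClosedMap _ S.isClosed
  have : CompleteSpace R := hcl.completeSpace_coe
  set p := R.orthogonalProjectionOnto f with hp
  have hq : f - p ∈ Rᗮ := Submodule.sub_starProjection_mem_orthogonal f
  obtain ⟨g, hg, hgp⟩ := p.2
  refine ⟨g, hg, ?_⟩
  have hpS : (p : HardyDisc E) ∈ S := by
    rw [← hgp]
    exact hS g hg
  -- The difference lies in `S` and is orthogonal to `zS`, so it belongs to `W`. It is then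
  -- orthogonal both to `f` and to `p`, hence to itself.
  have hq0 : f - p = 0 := by
    rw [← inner_self_eq_zero (𝕜 := ℂ)]
    conv_lhs => rw [inner_sub_left]
    rw [h _ ⟨S.toSubmodule.sub_mem hf hpS, hq⟩,
      (Submodule.mem_orthogonal _ _).1 hq _ p.2, sub_zero]
  rw [sub_eq_zero.1 hq0]
  exact hgp

/-- The isometry `f ↦ ∑ z ^ k f_k` of the Wold decomposition of `S`. -/
def woldIsometry (hS : ∀ f ∈ S, Mz E f ∈ S) : HardyDisc (wandering S) →ₗᵢ[ℂ] HardyDisc E :=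
  (orthogonalFamily_wanderingPow hS).linearIsometry

theorem hasSum_woldIsometry (hS : ∀ f ∈ S, Mz E f ∈ S) (f : HardyDisc (wandering S)) :
    HasSum (fun k => wanderingPow S k (f.coeff k)) (woldIsometry hS f) :=
  (orthogonalFamily_wanderingPow hS).hasSum_linearIsometry f

/-- Evaluating the series termwise gives `∑ w ^ k f_k(w)`, with each `f_k ∈ W` itself a function on
the disc, and this is `Θ(w)` applied to `f w`. -/
theorem woldIsometry_apply (hS : ∀ f ∈ S, Mz E f ∈ S) (f : HardyDisc (wandering S)) (w : 𝔻) :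
    woldIsometry hS f w = blh S w (f w) := by
  have h1 := (HardyDisc.evalCLM w).hasSum (hasSum_woldIsometry hS f)
  have h2 := (blh S w).hasSum (HardyDisc.hasSum_apply f w)
  refine h1.unique ?_
  convert h2 using 2 with k
  rw [HardyDisc.evalCLM_apply, wanderingPow_apply, HardyDisc.Mz_pow_apply, map_smul, blh_apply]

theorem range_woldIsometry (hS : ∀ f ∈ S, Mz E f ∈ S) :
    Set.range (woldIsometry hS) = (S : Set (HardyDisc E)) := by
  set N : Submodule ℂ (HardyDisc E) :=
    (⨆ k, LinearMap.range (wanderingPow S k).toLinearMap).topologicalClosure with hN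
  have hr : Set.range (woldIsometry hS) = (N : Set (HardyDisc E)) :=
    congrArg (fun M : Submodule ℂ (HardyDisc E) => (M : Set (HardyDisc E)))
      (orthogonalFamily_wanderingPow hS).range_linearIsometry
  rw [hr]
  have hNS : ∀ f ∈ N, f ∈ S := by
    refine Submodule.topologicalClosure_minimal (t := S.toSubmodule) _ (iSup_le ?_) S.isClosed
    rintro k _ ⟨η, rfl⟩
    exact Mz_pow_mem hS k η.2.1
  refine Set.Subset.antisymm hNS fun f hf => ?_
  have : CompleteSpace N := (Submodule.isClosed_topologicalClosure _).completeSpace_coe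
  set p := N.orthogonalProjectionOnto f with hp
  have hq : f - p ∈ Nᗮ := Submodule.sub_starProjection_mem_orthogonal f
  have hqS : f - p ∈ S := S.toSubmodule.sub_mem hf (hNS _ p.2)
  -- If `f - p = z ^ k g` with `g ∈ S`, then orthogonality to `z ^ k W` says that `g` is orthogonal
  -- to `W`, so one more factor `z` can be split off inside `S`.
  have hdiv : ∀ k, ∃ g ∈ S, (Mz E ^ k) g = f - p := fun k => by
    induction k with
    | zero => exact ⟨f - p, hqS, by simp⟩
    | succ k ih =>
      obtain ⟨g, hg, hgk⟩ := ih
      obtain ⟨g', hg', rfl⟩ := exists_Mz_eq_of_orthogonal hS hg fun η hη => by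
        rw [← HardyDisc.inner_Mz_pow k, hgk]
        refine (Submodule.mem_orthogonal' _ _).1 hq _ ?_
        refine Submodule.le_topologicalClosure _ (Submodule.mem_iSup_of_mem k ?_)
        exact ⟨⟨η, hη⟩, rfl⟩
      exact ⟨g', hg', by rw [← hgk, pow_succ, mul_apply_eq_comp]⟩
  have hq0 : f - p = 0 := by
    refine HardyDisc.coeff_injective (funext fun j => ?_)
    obtain ⟨g, -, hg⟩ := hdiv (j + 1)
    rw [← hg, HardyDisc.coeff_Mz_pow_of_lt (Nat.lt_succ_self j)]
    rfl
  rw [sub_eq_zero.1 hq0]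
  exact p.2

theorem isMultiplier_blh (hS : ∀ f ∈ S, Mz E f ∈ S) :
    IsMultiplier (HardyDisc (wandering S)) (HardyDisc E) (blh S) :=
  ⟨(woldIsometry hS).toContinuousLinearMap, woldIsometry_apply hS⟩

theorem mulOp_blh (hS : ∀ f ∈ S, Mz E f ∈ S) :
    mulOp (HardyDisc (wandering S)) (HardyDisc E) (blh S) =
      (woldIsometry hS).toContinuousLinearMap :=
  mulOp_unique _ (woldIsometry_apply hS)

theorem norm_mulOp_blh (hS : ∀ f ∈ S, Mz E f ∈ S) (f : HardyDisc (wandering S)) :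
    ‖mulOp (HardyDisc (wandering S)) (HardyDisc E) (blh S) f‖ = ‖f‖ := by
  rw [mulOp_blh hS]
  exact (woldIsometry hS).norm_map f

theorem range_mulOp_blh (hS : ∀ f ∈ S, Mz E f ∈ S) :
    Set.range (mulOp (HardyDisc (wandering S)) (HardyDisc E) (blh S)) = S := by
  rw [mulOp_blh hS]
  exact range_woldIsometry hS

theorem mulOp_blh_monomial_zero (hS : ∀ f ∈ S, Mz E f ∈ S) (η : wandering S) :
    mulOp (HardyDisc (wandering S)) (HardyDisc E) (blh S) (HardyDisc.monomial 0 η) = η :=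
  RKHS.ext (𝕜 := ℂ) fun w => by
    rw [mulOp_apply (isMultiplier_blh hS), HardyDisc.monomial_apply, pow_zero, one_smul, blh_apply]

theorem isInner_blh (hS : ∀ f ∈ S, Mz E f ∈ S) : IsInner (blh S) :=
  isInner_of_isometry (exists_differentiableOn_evalCLM_comp (wandering S).subtypeL)
    (woldIsometry hS) (woldIsometry_apply hS)

theorem inner_mulOp_blh (hS : ∀ f ∈ S, Mz E f ∈ S) (f g : HardyDisc (wandering S)) :
    ⟪mulOp (HardyDisc (wandering S)) (HardyDisc E) (blh S) f,
      mulOp (HardyDisc (wandering S)) (HardyDisc E) (blh S) g⟫_ℂ = ⟪f, g⟫_ℂ := by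
  rw [mulOp_blh hS]
  exact (woldIsometry hS).inner_map_map f g

theorem adjoint_mulOp_blh_apply (hS : ∀ f ∈ S, Mz E f ∈ S) (f : HardyDisc (wandering S)) :
    (mulOp (HardyDisc (wandering S)) (HardyDisc E) (blh S)).adjoint
      (mulOp (HardyDisc (wandering S)) (HardyDisc E) (blh S) f) = f :=
  ext_inner_right ℂ fun g => by
    rw [ContinuousLinearMap.adjoint_inner_left, inner_mulOp_blh hS]

theorem mulOp_blh_adjoint_apply (hS : ∀ f ∈ S, Mz E f ∈ S) {f : HardyDisc E} (hf : f ∈ S) :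
    mulOp (HardyDisc (wandering S)) (HardyDisc E) (blh S)
      ((mulOp (HardyDisc (wandering S)) (HardyDisc E) (blh S)).adjoint f) = f := by
  obtain ⟨g, rfl⟩ := (range_mulOp_blh hS).ge hf
  rw [adjoint_mulOp_blh_apply hS]

theorem mulOp_blh_Mz (hS : ∀ f ∈ S, Mz E f ∈ S) (f : HardyDisc (wandering S)) :
    mulOp (HardyDisc (wandering S)) (HardyDisc E) (blh S) (Mz _ f) =
      Mz E (mulOp (HardyDisc (wandering S)) (HardyDisc E) (blh S) f) :=
  RKHS.ext (𝕜 := ℂ) fun w => by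
    rw [mulOp_apply (isMultiplier_blh hS), Mz_apply, Mz_apply, map_smul,
      mulOp_apply (isMultiplier_blh hS)]

/-- The compression of `A` is the symbol `η ↦ M_Θ^* A η` of the operator `M_Θ^* A M_Θ`. -/
theorem compressed_blh_apply (hS : ∀ f ∈ S, Mz E f ∈ S) (A : HardyDisc E →L[ℂ] HardyDisc E)
    (w : 𝔻) (η : wandering S) :
    compressed S (blh S) A w η =
      (mulOp (HardyDisc (wandering S)) (HardyDisc E) (blh S)).adjoint (A η) w := by
  set M := mulOp (HardyDisc (wandering S)) (HardyDisc E) (blh S) with hM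
  set h := M.adjoint (A η) with hh
  set R : HardyDisc (wandering S) →L[ℂ] HardyDisc (wandering S) :=
    1 - (w : ℂ) • (Mz (wandering S)).adjoint with hR
  -- A contraction scaled by `|w| < 1`: `Ring.inverse` is a true inverse here and not its default
  -- value `0`.
  have hunit : IsUnit R := by
    refine isUnit_one_sub_of_norm_lt_one ?_
    have h1 : ‖(Mz (wandering S)).adjoint‖ ≤ 1 := by
      rw [LinearIsometryEquiv.norm_map]
      exact ContinuousLinearMap.opNorm_le_bound _ zero_le_one fun f => by
        rw [HardyDisc.norm_Mz, one_mul]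
    rw [norm_smul]
    exact (mul_le_of_le_one_right (norm_nonneg _) h1).trans_lt w.norm_lt_one
  have hRx : R (Ring.inverse R h) = h := by
    rw [← mul_apply_eq_comp, Ring.mul_inverse_cancel _ hunit, one_apply_eq_self]
  change (wandering S).orthogonalProjectionOnto (M (Ring.inverse R h)) = h w
  generalize Ring.inverse R h = x at hRx
  -- With `R x = h`, pairing the left side with `v` gives `⟪x, v⟫`, where `v` is now the constant
  -- function, equal to `(1 - w̄ M_z) k_w v`. Moving this operator across turns it into `⟪R x, k_w
  -- v⟫ = ⟪h w, v⟫`.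
  refine ext_inner_right ℂ fun v => ?_
  rw [Submodule.inner_orthogonalProjectionOnto_eq_of_mem_right, ← mulOp_blh_monomial_zero hS v,
    inner_mulOp_blh hS, ← HardyDisc.kerFun_sub_smul_Mz w v, ← RKHS.inner_kerFun, ← hRx, hR,
    sub_apply, smul_apply, one_apply_eq_self, inner_sub_left, inner_sub_right, inner_smul_left,
    inner_smul_right, ContinuousLinearMap.adjoint_inner_left (Mz (wandering S))]

end BeurlingLaxHalmos

/-! ### Restrictions to an invariant subspace -/

section Restriction

variable {E : Type*} [NormedAddCommGroup E] [InnerProductSpace ℂ E] [CompleteSpace E]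
  {S : ClosedSubmodule ℂ (HardyDisc E)}

/-- If `S` is invariant for an operator `A` commuting with `M_z`, then multiplication by the
compression of `A` is `M_Θ^* A M_Θ`. -/
theorem compressed_blh_multiplier (hS : ∀ f ∈ S, Mz E f ∈ S) {A : HardyDisc E →L[ℂ] HardyDisc E}
    (hA : ∀ f, A (Mz E f) = Mz E (A f)) (hAS : ∀ f ∈ S, A f ∈ S)
    (f : HardyDisc (wandering S)) (w : 𝔻) :
    ((mulOp (HardyDisc (wandering S)) (HardyDisc E) (blh S)).adjoint ∘L A ∘L
      mulOp (HardyDisc (wandering S)) (HardyDisc E) (blh S)) f w =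
      compressed S (blh S) A w (f w) := by
  refine apply_of_comm_Mz (fun g => ?_) (fun w v => ?_) f w
  · have hmem : A (mulOp (HardyDisc (wandering S)) (HardyDisc E) (blh S) g) ∈ S :=
      hAS _ ((range_mulOp_blh hS).le ⟨g, rfl⟩)
    simp only [ContinuousLinearMap.comp_apply]
    rw [mulOp_blh_Mz hS, hA]
    -- Invariance of `S` enters here: `A M_Θ g` lies in `S`, so it can be rewritten as `M_Θ` of
    -- something, and `M_z` then passes through `M_Θ`.
    conv_lhs => rw [← mulOp_blh_adjoint_apply hS hmem]
    rw [← mulOp_blh_Mz hS, adjoint_mulOp_blh_apply hS]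
  · rw [compressed_blh_apply hS, ContinuousLinearMap.comp_apply, ContinuousLinearMap.comp_apply,
      mulOp_blh_monomial_zero hS]

/-- `M_Θ` intertwines multiplication by the compression of `A` and `A`. -/
theorem mulOp_blh_mulOp_compressed (hS : ∀ f ∈ S, Mz E f ∈ S)
    {A : HardyDisc E →L[ℂ] HardyDisc E} (hA : ∀ f, A (Mz E f) = Mz E (A f))
    (hAS : ∀ f ∈ S, A f ∈ S) (f : HardyDisc (wandering S)) :
    mulOp (HardyDisc (wandering S)) (HardyDisc E) (blh S)
      (mulOp (HardyDisc (wandering S)) (HardyDisc (wandering S))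
        (compressed S (blh S) A) f) =
      A (mulOp (HardyDisc (wandering S)) (HardyDisc E) (blh S) f) := by
  rw [mulOp_unique _ (compressed_blh_multiplier hS hA hAS)]
  exact mulOp_blh_adjoint_apply hS (hAS _ ((range_mulOp_blh hS).le ⟨f, rfl⟩))

/-- An operator which an isometry intertwines with a shift is a shift. -/
theorem IsShift.of_intertwining {H K : Type*} [NormedAddCommGroup H] [InnerProductSpace ℂ H]
    [CompleteSpace H] [NormedAddCommGroup K] [InnerProductSpace ℂ K] [CompleteSpace K]
    {V : K →L[ℂ] K} (hV : IsShift V) {M : H →L[ℂ] K} (hM : ∀ f, ‖M f‖ = ‖f‖) {B : H →L[ℂ] H}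
    (h : ∀ f, M (B f) = V (M f)) : IsShift B := by
  have hinner : ∀ f g, ⟪M f, M g⟫_ℂ = ⟪f, g⟫_ℂ :=
    LinearIsometry.inner_map_map ⟨M.toLinearMap, hM⟩
  have hpow : ∀ (m : ℕ) f, M ((B ^ m) f) = (V ^ m) (M f) := fun m f => by
    induction m with
    | zero => simp
    | succ m ih => rw [pow_succ', mul_apply_eq_comp, h, ih, pow_succ', mul_apply_eq_comp]
  have hM1 : ‖M.adjoint‖ ≤ 1 := by
    rw [LinearIsometryEquiv.norm_map]
    exact M.opNorm_le_bound zero_le_one fun f => by rw [hM, one_mul]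
  refine ⟨fun f => by rw [← hM, h, hV.1, hM], fun f => ?_⟩
  refine squeeze_zero (fun _ => norm_nonneg _) (fun m => ?_) (hV.2 (M f))
  -- The powers of `B.adjoint` are compressions of those of `V.adjoint`, although `M` need not be
  -- onto; this transfers the decay.
  have hadj : (B.adjoint ^ m) f = M.adjoint ((V.adjoint ^ m) (M f)) :=
    ext_inner_right ℂ fun g => by
      rw [inner_adjoint_pow, ContinuousLinearMap.adjoint_inner_left, inner_adjoint_pow, ← hpow,
        hinner]
  rw [hadj]
  simpa using M.adjoint.le_of_opNorm_le hM1 ((V.adjoint ^ m) (M f))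

/-- The unitary `M_Θ^*` from `S` to the Hardy space of its wandering subspace. -/
theorem exists_unitary_mulOp_blh (hS : ∀ f ∈ S, Mz E f ∈ S) :
    ∃ U : S.toSubmodule ≃ₗᵢ[ℂ] HardyDisc (wandering S),
      ∀ f, mulOp (HardyDisc (wandering S)) (HardyDisc E) (blh S) (U f) = f := by
  have hmem : ∀ g, woldIsometry hS g ∈ S.toSubmodule := fun g => (range_woldIsometry hS).le ⟨g, rfl⟩
  let T : HardyDisc (wandering S) →ₗᵢ[ℂ] S.toSubmodule :=
    ⟨(woldIsometry hS).toLinearMap.codRestrict S.toSubmodule hmem, (woldIsometry hS).norm_map⟩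
  have hT : Function.Surjective T := fun f => by
    obtain ⟨g, hg⟩ := (range_woldIsometry hS).ge f.2
    exact ⟨g, Subtype.ext hg⟩
  refine ⟨(LinearIsometryEquiv.ofSurjective T hT).symm, fun f => ?_⟩
  rw [mulOp_blh hS]
  exact congrArg Subtype.val ((LinearIsometryEquiv.ofSurjective T hT).apply_symm_apply f)

end Restriction

end

theorem theorem3p7 {E : Type*} [NormedAddCommGroup E] [InnerProductSpace ℂ E] [CompleteSpace E]
    (n : ℕ) (S : ClosedSubmodule ℂ (HardyDisc (HardyPoly n E)))
    (hS : ∀ f ∈ S, Mz (HardyPoly n E) f ∈ S)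
    (Θ : 𝔻 → wandering S →L[ℂ] HardyPoly n E) (hΘ : Θ = blh S)
    (Φ : Fin n → 𝔻 → wandering S →L[ℂ] wandering S)
    (hΦ : ∀ i, Φ i = compressed S Θ (Mkappa E i))
    (MΦ : Fin n → HardyDisc (wandering S) →L[ℂ] HardyDisc (wandering S))
    (hMΦ : ∀ i, MΦ i = mulOp _ _ (Φ i)) :
    (IsInner Θ ∧
      Set.range (mulOp (HardyDisc (wandering S)) (HardyDisc (HardyPoly n E)) Θ) = S) ∧
    ((∀ i, ∀ f ∈ S, Mkappa E i f ∈ S) ↔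
      ((∀ i, IsMultiplier (HardyDisc (wandering S)) (HardyDisc (wandering S)) (Φ i)) ∧
        (∀ i, IsShift (MΦ i)) ∧ (∀ i j, Commute (MΦ i) (MΦ j))) ∧
      ∀ i w, kappa E i w ∘L Θ w = Θ w ∘L Φ i w) ∧
    ∀ hκ : ∀ i, ∀ f ∈ S, Mkappa E i f ∈ S,
      ∃ U : S.toSubmodule ≃ₗᵢ[ℂ] HardyDisc (wandering S),
        (∀ f : S.toSubmodule, U ⟨Mz _ f, hS f f.2⟩ = Mz _ (U f)) ∧
        ∀ i, ∀ f : S.toSubmodule, U ⟨Mkappa E i f, hκ i f f.2⟩ = MΦ i (U f) := by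
  subst hΘ
  obtain rfl : Φ = fun i => compressed S (blh S) (Mkappa E i) := funext hΦ
  obtain rfl : MΦ = fun i => mulOp _ _ (compressed S (blh S) (Mkappa E i)) := funext hMΦ
  clear hΦ hMΦ
  -- Identities in the Hardy space of `W` are checked after applying `M_Θ`, where they become
  -- identities for `M_{κ_i}` and `M_z`.
  have hinj : Function.Injective (mulOp (HardyDisc (wandering S)) (HardyDisc (HardyPoly n E))
      (blh S)) := Function.LeftInverse.injective (adjoint_mulOp_blh_apply hS)
  refine ⟨⟨isInner_blh hS, range_mulOp_blh hS⟩, ⟨fun hκ => ?_, ?_⟩, fun hκ => ?_⟩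
  · have hint := fun i => mulOp_blh_mulOp_compressed hS (Mkappa_Mz i) (hκ i)
    refine ⟨⟨fun i => ⟨_, compressed_blh_multiplier hS (Mkappa_Mz i) (hκ i)⟩,
      fun i => (isShift_Mkappa i).of_intertwining (norm_mulOp_blh hS) (hint i), fun i j => ?_⟩,
      fun i w => ?_⟩
    · refine ContinuousLinearMap.ext fun f => hinj ?_
      rw [mul_apply_eq_comp, mul_apply_eq_comp, hint, hint, hint, hint, Mkappa_comm]
    -- Since `M_{κ_i} η ∈ S`, applying `M_Θ M_Θ^*` leaves it unchanged; its value at `w` is the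
    -- required identity.
    · refine ContinuousLinearMap.ext fun η => ?_
      rw [ContinuousLinearMap.comp_apply, ContinuousLinearMap.comp_apply,
        compressed_blh_apply hS, ← mulOp_apply (isMultiplier_blh hS),
        mulOp_blh_adjoint_apply hS (hκ i _ (mem_of_mem_wandering S η.2)), Mkappa_apply, blh_apply]
      rfl
  · rintro ⟨⟨hm, -, -⟩, hc⟩ i f hf
    obtain ⟨g, rfl⟩ := (range_mulOp_blh hS).ge hf
    -- The preimage is `M_{Φ_i} g`. Boundedness of the multiplier guarantees that `mulOp` is actual
    -- multiplication and not the default zero operator.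
    refine (range_mulOp_blh hS).le ⟨mulOp _ _ (compressed S (blh S) (Mkappa E i)) g, ?_⟩
    refine RKHS.ext (𝕜 := ℂ) fun w => ?_
    rw [mulOp_apply (isMultiplier_blh hS), mulOp_apply (hm i), Mkappa_apply,
      mulOp_apply (isMultiplier_blh hS)]
    exact (congrArg (fun B => B (g w)) (hc i w)).symm
  · obtain ⟨U, hU⟩ := exists_unitary_mulOp_blh hS
    refine ⟨U, fun f => hinj ?_, fun i f => hinj ?_⟩
    · rw [hU, mulOp_blh_Mz hS, hU]
    · rw [hU, mulOp_blh_mulOp_compressed hS (Mkappa_Mz i) (hκ i), hU]
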